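/- Let $(X_{ij})_{i,j\ge 1}$ be i.i.d. complex random variables with common law $F$, and suppose that (H1) holds: there are $\alpha\in(0,2)$ and a slowly varying function $L$ (i.e. $\lim_{t\to\infty}L(xt)/L(t)=1$ for every $x>0$) such that $\mathbb{P}(|X_{11}|\ge t)=L(t)\,t^{-\alpha}$ for all $t\ge 1$, and there is a probability measure $\theta$ on the unit circle $\mathbb{S}^1\subset\mathbb{C}$ such that, for every Borel set $D\subset\mathbb{S}^1$, $\lim_{t\to\infty}\mathbb{P}\left(X_{11}/|X_{11}|\in D\mid |X_{11}|\ge t\right)=\theta(D)$. For $n\ge1$ let $a_n:=\inf\{a>0:\ n\,\mathbb{P}(|X_{11}|\ge a)\le 1\}$ and let $A=A_n$ be the $n\times n$ matrix with entries $A_{ij}=a_n^{-1}X_{ij}$ (one has $a_n>0$ for all large $n$). Let $0<\gamma<1/2$. Then there is $\delta>0$, depending only on $\alpha$ and $\gamma$, and an integer $N$, depending only on $\gamma$ and the law $F$, such that the following holds for every $n\ge N$, every $z\in\mathbb{C}$ and every row $R$ of the matrix $a_n(A-zI)$: for every linear subspace $W\subset\mathbb{C}^n$ with $n-\dim W\ge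 n^{1-\gamma}$, $$\mathbb{P}\left(\mathrm{dist}(R,W)\le n^{(1-2\gamma)/\alpha}\right)\le e^{-n^{\delta}},$$ where $\mathrm{dist}$ is the Euclidean (Hermitian) distance in $\mathbb{C}^n$. -/

import Mathlib

open MeasureTheory ProbabilityTheory Filter Topology

/-- `L` is slowly varying (at infinity): `L (x t) / L t → 1` as `t → ∞`, for every `x > 0`. -/
def SlowlyVarying (L : ℝ → ℝ) : Prop :=
  ∀ x : ℝ, 0 < x → Tendsto (fun t : ℝ => L (x * t) / L t) atTop (𝓝 1)

/-- The hypothesis (H1) on the law `F` of a complex random variable, with tail index `α`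
(the condition `α ∈ (0, 2)` is imposed separately): the modulus has tail `L(t) t^{-α}` for `t ≥ 1`,
with `L` slowly varying, and the law of the phase conditional on the modulus being at least `t`
converges, as `t → ∞`, on every Borel subset of the unit circle, to a probability measure `θ`. -/
def HypH1 (α : ℝ) (F : Measure ℂ) : Prop :=
  (∃ L : ℝ → ℝ, SlowlyVarying L ∧
    ∀ t : ℝ, 1 ≤ t → F.real {x : ℂ | t ≤ ‖x‖} = L t * t ^ (-α)) ∧
  ∃ θ : Measure ℂ, IsProbabilityMeasure θ ∧ θ (Metric.sphere 0 1) = 1 ∧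
    ∀ D : Set ℂ, D ⊆ Metric.sphere 0 1 → MeasurableSet D →
      Tendsto
        (fun t : ℝ => (cond F {x : ℂ | t ≤ ‖x‖}).real {x : ℂ | x / (‖x‖ : ℂ) ∈ D})
        atTop (𝓝 (θ.real D))

/-- The normalizing sequence `a_n = inf {a > 0 : n P(|X₁₁| ≥ a) ≤ 1}`, in terms of the law `F`
of `X₁₁`. -/
noncomputable def normSeq (F : Measure ℂ) (n : ℕ) : ℝ :=
  sInf {a : ℝ | 0 < a ∧ (n : ℝ) * F.real {x : ℂ | a ≤ ‖x‖} ≤ 1}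

/-- `X` is an infinite array of independent complex random variables with common law `F`
(rows and columns are numbered from `0`). -/
structure IsIIDArray {Ω : Type*} [MeasurableSpace Ω] (P : Measure Ω) (F : Measure ℂ)
    (X : ℕ → ℕ → Ω → ℂ) : Prop where
  measurable : ∀ i j, Measurable (X i j)
  law : ∀ i j, Measure.map (X i j) P = F
  indep : iIndepFun (fun p : ℕ × ℕ => X p.1 p.2) P

/-- The random matrix `A = A_n`, with entries `a_n⁻¹ X_{ij}`. -/
noncomputable def matA {Ω : Type*} (F : Measure ℂ) (X : ℕ → ℕ → Ω → ℂ) (n : ℕ) (ω : Ω) :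
    Matrix (Fin n) (Fin n) ℂ :=
  Matrix.of fun i j => ((normSeq F n : ℝ) : ℂ)⁻¹ * X i j ω

/-- The `i`-th row of the matrix `a_n (A - z I)`, as a vector of the Hermitian space `ℂⁿ`. -/
noncomputable def scaledRow {Ω : Type*} (F : Measure ℂ) (X : ℕ → ℕ → Ω → ℂ) (n : ℕ) (z : ℂ)
    (i : Fin n) (ω : Ω) : EuclideanSpace ℂ (Fin n) :=
  WithLp.toLp 2
    ((((normSeq F n : ℝ) : ℂ) • (matA F X n ω - z • (1 : Matrix (Fin n) (Fin n) ℂ))).row i)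

/-! The distance to `W` is the norm of the projection of the row onto `K = Wᗮ`, of dimension at
least `n^(1-γ)`. The projection has trace `dim K`, so some coordinate vector has a projection `w`
with `‖w‖² ≥ κ/n` while `dim K ≥ κ`. With the other coordinates frozen, a small projection confines
that coordinate to a ball of radius `s √(n/κ)`; it also forces a small projection onto `K ⊓ wᗮ`, an
event free of that coordinate. Peeling off `m` directions yields `q ^ m`
(`pi_norm_starProjection_le`).

For `s = n^((1-2γ)/α)` and `κ ≈ m ≈ n^(1-γ)/2` the radius is of order `n^β`, `β = (1-2γ)/α + γ/2`.
The heavy tail (`SlowlyVarying.exists_rpow_le`) gives `1 - q ≥ c n^(-β(α+ε))`, and `1 - γ - αβ = γ(1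
- α/2) > 0`, so `m (1 - q)` is at least a power of `n`. -/

/-! ### Small ball estimate for projections of product measures. -/

/-- If `E ⊆ E'`, `E'` does not depend on the coordinate `j`, and every section of `E` along the
coordinate `j` has mass at most `q`, then the product measure of `E` is at most `q` times
that of `E'`. -/
theorem pi_measure_le_mul_of_section_le {ι : Type*} [Fintype ι] [DecidableEq ι] {Y : Type*}
    [MeasurableSpace Y] (F : Measure Y) [IsProbabilityMeasure F] (j : ι) {E E' : Set (ι → Y)}
    (hE : MeasurableSet E) (hE' : MeasurableSet E') (hsub : E ⊆ E')
    (hinv : ∀ x y, Function.update x j y ∈ E' ↔ x ∈ E') {q : ENNReal}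
    (hq : ∀ x, F {y | Function.update x j y ∈ E} ≤ q) :
    Measure.pi (fun _ : ι => F) E ≤ q * Measure.pi (fun _ : ι => F) E' := by
  have key := lintegral_le_of_lmarginal_le (μ := fun _ : ι => F) {j}
    (f := E.indicator 1) (g := fun x => q * E'.indicator 1 x)
    (measurable_one.indicator hE) ((measurable_one.indicator hE').const_mul q) ?_
  · rwa [lintegral_const_mul _ (measurable_one.indicator hE'), lintegral_indicator_one hE,
      lintegral_indicator_one hE'] at key
  · rw [lmarginal_singleton, lmarginal_singleton]
    intro x
    have h1 : ∀ y, E'.indicator (1 : (ι → Y) → ENNReal) (Function.update x j y)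
        = E'.indicator 1 x := by
      intro y
      by_cases hx : x ∈ E'
      · rw [Set.indicator_of_mem hx, Set.indicator_of_mem ((hinv x y).2 hx)]; rfl
      · rw [Set.indicator_of_notMem hx, Set.indicator_of_notMem (fun h => hx ((hinv x y).1 h))]
    have h2 : ∀ y, E.indicator (1 : (ι → Y) → ENNReal) (Function.update x j y)
        = {y | Function.update x j y ∈ E}.indicator 1 y := fun y => rfl
    have h3 : MeasurableSet {y | Function.update x j y ∈ E} := measurable_update x hE
    simp only [h1, h2]
    rw [lintegral_indicator_one h3, lintegral_const, measure_univ, mul_one]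
    by_cases hx : x ∈ E'
    · simpa [hx] using hq x
    · have : {y | Function.update x j y ∈ E} = ∅ := by
        ext y
        simp only [Set.mem_ofPred_eq, Set.mem_empty_iff_false, iff_false]
        exact fun h => hx ((hinv x y).1 (hsub h))
      simp [this]

/-- The trace of an orthogonal projection is the dimension of its range. -/
theorem sum_norm_sq_starProjection {𝕜 E ι : Type*} [RCLike 𝕜] [NormedAddCommGroup E]
    [InnerProductSpace 𝕜 E] [FiniteDimensional 𝕜 E] [Fintype ι] (e : OrthonormalBasis ι 𝕜 E)
    (K : Submodule 𝕜 E) :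
    ∑ j, ‖K.starProjection (e j)‖ ^ 2 = Module.finrank 𝕜 K := by
  let b := stdOrthonormalBasis 𝕜 K
  have h1 : ∀ j, ‖K.starProjection (e j)‖ ^ 2 = ∑ i, ‖inner 𝕜 (b i : E) (e j)‖ ^ 2 := by
    intro j
    rw [Submodule.starProjection_apply, Submodule.norm_coe, ← b.sum_sq_norm_inner_right]
    simp
  simp_rw [h1]
  rw [Finset.sum_comm]
  have h2 : ∀ i, ∑ j, ‖inner 𝕜 (b i : E) (e j)‖ ^ 2 = 1 := by
    intro i
    rw [e.sum_sq_norm_inner_left, Submodule.norm_coe, b.orthonormal.1 i, one_pow]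
  simp [h2]

/-- A small ball estimate: if every ball of radius `s √(n/κ)` has `F`-mass at most `q`, then the
projection onto a space of dimension at least `κ + m` of a translate of a random vector
with independent coordinates of law `F` has norm at most `s` with probability at most `q ^ m`. -/
theorem pi_norm_starProjection_le {n : ℕ} (F : Measure ℂ) [IsProbabilityMeasure F]
    (q : ENNReal) {s κ : ℝ} (hκ : 0 < κ)
    (hq : ∀ c : ℂ, F (Metric.closedBall c (s * √(n / κ))) ≤ q) (v : EuclideanSpace ℂ (Fin n))
    (m : ℕ) (K : Submodule ℂ (EuclideanSpace ℂ (Fin n)))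
    (hK : κ + m ≤ Module.finrank ℂ K) :
    Measure.pi (fun _ : Fin n => F) {x | ‖K.starProjection (WithLp.toLp 2 x + v)‖ ≤ s} ≤ q ^ m := by
  induction m generalizing K with
  | zero => simpa using prob_le_one
  | succ m ih =>
    push_cast at hK
    have hm : (0 : ℝ) ≤ m := m.cast_nonneg
    have hn : 0 < n := by
      have h1 : Module.finrank ℂ K ≤ n := by simpa using K.finrank_le
      have h2 : (0 : ℝ) < Module.finrank ℂ K := by linarith
      exact (Nat.cast_pos.1 h2).trans_le h1
    have hn' : (0 : ℝ) < n := Nat.cast_pos.2 hn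
    have : Nonempty (Fin n) := ⟨⟨0, hn⟩⟩
    let e : Fin n → EuclideanSpace ℂ (Fin n) := fun j => EuclideanSpace.single j 1
    -- Averaging: the `n` squared norms sum to `dim K ≥ κ`.
    obtain ⟨j, -, hj⟩ : ∃ j ∈ Finset.univ, κ / n ≤ ‖K.starProjection (e j)‖ ^ 2 := by
      apply Finset.exists_le_of_sum_le Finset.univ_nonempty
      have := sum_norm_sq_starProjection (EuclideanSpace.basisFun (Fin n) ℂ) K
      simp only [EuclideanSpace.basisFun_apply] at this
      rw [this, Finset.sum_const, Finset.card_univ, Fintype.card_fin, nsmul_eq_mul,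
        mul_div_cancel₀ _ hn'.ne']
      linarith
    set w := K.starProjection (e j) with hw
    have hwK : w ∈ K := K.starProjection_apply_mem _
    have hw0 : 0 < ‖w‖ := by
      refine (norm_nonneg w).lt_of_ne fun h => ?_
      rw [← h] at hj
      have := div_pos hκ hn'
      norm_num at hj
      linarith
    -- Removing `w` costs one dimension and makes `e j` orthogonal to `K'`, so the event for `K'`
    -- ignores coordinate `j`.
    let K' : Submodule ℂ (EuclideanSpace ℂ (Fin n)) := (ℂ ∙ w)ᗮ ⊓ K
    have hK'K : K' ≤ K := inf_le_right
    have hdim : κ + m ≤ Module.finrank ℂ K' := by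
      have h1 := Submodule.finrank_add_inf_finrank_orthogonal
        (K₁ := ℂ ∙ w) (K₂ := K) ((Submodule.span_singleton_le_iff_mem _ _).2 hwK)
      rw [finrank_span_singleton (norm_pos_iff.1 hw0)] at h1
      have h2 : (1 : ℝ) + Module.finrank ℂ K' = Module.finrank ℂ K := by exact_mod_cast h1
      linarith
    have hupd : ∀ (x : Fin n → ℂ) (y : ℂ), (WithLp.toLp 2 (Function.update x j y) + v :
        EuclideanSpace ℂ (Fin n)) = (WithLp.toLp 2 x + v) + (y - x j) • e j := by
      intro x y
      ext k
      by_cases hk : k = j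
      · subst hk; simp [e]; ring
      · simp [e, hk]
    have hmeas : ∀ U : Submodule ℂ (EuclideanSpace ℂ (Fin n)), MeasurableSet
        {x : Fin n → ℂ | ‖U.starProjection (WithLp.toLp 2 x + v)‖ ≤ s} := by
      intro U
      have : Continuous fun x : Fin n → ℂ => ‖U.starProjection (WithLp.toLp 2 x + v)‖ := by
        fun_prop
      exact (isClosed_le this continuous_const).measurableSet
    have hK'e : K'.starProjection (e j) = 0 := by
      rw [Submodule.starProjection_apply_eq_zero_iff]
      intro y hy
      have h1 : inner ℂ w y = 0 := Submodule.mem_orthogonal_singleton_iff_inner_right.1 hy.1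
      have h2 : inner ℂ (e j - w) y = 0 := K.starProjection_inner_eq_zero _ _ hy.2
      rw [inner_sub_left, h1, sub_zero] at h2
      rw [← inner_conj_symm, h2, map_zero]
    refine (pi_measure_le_mul_of_section_le F j (hmeas K) (hmeas K') ?_ ?_ ?_).trans
      (b := q * _) ?_
    · intro x hx
      refine le_trans ?_ (show _ ≤ s from hx)
      have := congrArg (fun T => T (WithLp.toLp 2 x + v))
        (Submodule.starProjection_comp_starProjection_of_le hK'K)
      simp only [ContinuousLinearMap.comp_apply] at this
      rw [← this]
      exact K'.norm_starProjection_apply_le _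
    · intro x y
      simp only [Set.mem_ofPred_eq]
      rw [hupd, map_add _ (WithLp.toLp 2 x + v), map_smul, hK'e, smul_zero, add_zero]
    · intro x
      -- The inner product of `w` with the projection is affine in `y` with slope `‖w‖²`; the centre
      -- is its zero, and Cauchy–Schwarz bounds the radius by `s / ‖w‖`.
      refine (measure_mono ?_).trans (hq (x j - inner ℂ w (WithLp.toLp 2 x + v) / (‖w‖ : ℂ) ^ 2))
      intro y hy
      have hy' : ‖K.starProjection ((WithLp.toLp 2 x + v) + (y - x j) • e j)‖ ≤ s := by
        rw [← hupd]; exact hy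
      have h1 : ∀ u, inner ℂ w (K.starProjection u) = inner ℂ w u := by
        intro u
        rw [← Submodule.inner_starProjection_left_eq_right, K.starProjection_eq_self_iff.2 hwK]
      have h2 : inner ℂ w (e j) = (‖w‖ : ℂ) ^ 2 := by
        rw [← h1, ← hw, inner_self_eq_norm_sq_to_K]; rfl
      have h3 := norm_inner_le_norm (𝕜 := ℂ) w
        (K.starProjection ((WithLp.toLp 2 x + v) + (y - x j) • e j))
      rw [h1, inner_add_right, inner_smul_right, h2] at h3
      have hwc : (‖w‖ : ℂ) ≠ 0 := by exact_mod_cast hw0.ne'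
      have h4 : inner ℂ w (WithLp.toLp 2 x + v) + (y - x j) * (‖w‖ : ℂ) ^ 2
          = (y - (x j - inner ℂ w (WithLp.toLp 2 x + v) / (‖w‖ : ℂ) ^ 2)) * (‖w‖ : ℂ) ^ 2 := by
        field_simp
        ring
      rw [h4, norm_mul, norm_pow, Complex.norm_real, norm_norm] at h3
      rw [Metric.mem_closedBall, dist_eq_norm]
      have h5 : ‖y - (x j - inner ℂ w (WithLp.toLp 2 x + v) / (‖w‖ : ℂ) ^ 2)‖ * ‖w‖ ≤ s := by
        refine le_of_mul_le_mul_right (a := ‖w‖) ?_ hw0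
        nlinarith [mul_le_mul_of_nonneg_left hy' hw0.le]
      have h6 : 1 ≤ ‖w‖ * √(n / κ) := by
        rw [← Real.sqrt_sq hw0.le, ← Real.sqrt_mul (by positivity)]
        rw [Real.one_le_sqrt]
        calc (1 : ℝ) = κ / n * (n / κ) := by field_simp
          _ ≤ _ := by gcongr
      calc _ ≤ ‖y - (x j - inner ℂ w (WithLp.toLp 2 x + v) / (‖w‖ : ℂ) ^ 2)‖
              * (‖w‖ * √(n / κ)) := le_mul_of_one_le_right (norm_nonneg _) h6
        _ ≤ _ := by rw [← mul_assoc]; gcongr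
    · rw [pow_succ']
      gcongr
      exact ih K' hdim

/-! ### Tails of the law. -/

theorem antitone_real_setOf_le_norm (F : Measure ℂ) [IsProbabilityMeasure F] :
    Antitone fun t : ℝ => F.real {x : ℂ | t ≤ ‖x‖} :=
  fun _ _ hst => measureReal_mono fun _ hx => hst.trans hx

theorem measurableSet_setOf_le_norm (t : ℝ) : MeasurableSet {x : ℂ | t ≤ ‖x‖} :=
  measurableSet_le measurable_const measurable_norm

theorem tendsto_real_setOf_le_norm (F : Measure ℂ) [IsProbabilityMeasure F] :
    Tendsto (fun t : ℝ => F.real {x : ℂ | t ≤ ‖x‖}) atTop (𝓝 0) := by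
  have h := tendsto_measure_iInter_atTop (μ := F) (s := fun t : ℝ => {x : ℂ | t ≤ ‖x‖})
    (fun t => (measurableSet_setOf_le_norm t).nullMeasurableSet)
    (fun _ _ hst _ hx => hst.trans hx) ⟨0, measure_ne_top _ _⟩
  have h0 : (⋂ t : ℝ, {x : ℂ | t ≤ ‖x‖}) = ∅ := by
    ext x
    simp only [Set.mem_iInter, Set.mem_ofPred_eq, Set.mem_empty_iff_false, iff_false, not_forall,
      not_le]
    exact ⟨‖x‖ + 1, by linarith⟩
  rw [h0, measure_empty] at h
  exact (ENNReal.tendsto_toReal ENNReal.zero_ne_top).comp h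

/-- A bound on the concentration function of a law in terms of its tail. -/
theorem real_closedBall_le_one_sub (F : Measure ℂ) [IsProbabilityMeasure F] {r : ℝ} (hr : 0 < r)
    (h2 : F.real {x : ℂ | r ≤ ‖x‖} ≤ 1 / 2) (c : ℂ) :
    F.real (Metric.closedBall c r) ≤ 1 - F.real {x : ℂ | 4 * r ≤ ‖x‖} := by
  -- A near centre keeps the ball inside `‖x‖ ≤ 3r`; a far one keeps it in `‖x‖ ≥ r`, of mass at
  -- most `1/2`.
  rcases le_or_gt ‖c‖ (2 * r) with hc | hc
  · rw [← probReal_compl_eq_one_sub (measurableSet_setOf_le_norm _)]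
    refine measureReal_mono fun x hx => ?_
    simp only [Set.mem_compl_iff, Set.mem_ofPred_eq, not_le]
    rw [Metric.mem_closedBall, dist_eq_norm] at hx
    have := norm_le_norm_add_norm_sub' x c
    linarith
  · have h3 : F.real (Metric.closedBall c r) ≤ F.real {x : ℂ | r ≤ ‖x‖} := by
      refine measureReal_mono fun x hx => ?_
      rw [Metric.mem_closedBall, dist_eq_norm] at hx
      have := norm_le_norm_add_norm_sub x c
      simp only [Set.mem_ofPred_eq]
      linarith
    have h4 := antitone_real_setOf_le_norm F (show r ≤ 4 * r by linarith)
    simp only at h4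
    linarith

theorem SlowlyVarying.eventually_ne_zero {L : ℝ → ℝ} (hL : SlowlyVarying L) :
    ∀ᶠ t in atTop, L t ≠ 0 := by
  -- As `x / 0 = 0`, a nonzero ratio has a nonzero denominator.
  filter_upwards [(hL 2 two_pos).eventually_ne one_ne_zero] with t ht h
  simp [h] at ht

/-- A tail of index `-α` is bounded below by every power with exponent less than `-α`. -/
theorem SlowlyVarying.exists_rpow_le {L G : ℝ → ℝ} (hL : SlowlyVarying L) {α ε : ℝ} (hα : 0 < α)
    (hε : 0 < ε) (hG : Antitone G) (hG0 : ∀ t, 0 ≤ G t)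
    (hGL : ∀ t, 1 ≤ t → G t = L t * t ^ (-α)) :
    ∃ C T : ℝ, 0 < C ∧ 0 < T ∧ ∀ t, T ≤ t → C * t ^ (-(α + ε)) ≤ G t := by
  have hρ : (2 : ℝ) ^ (-ε) < 1 := Real.rpow_lt_one_of_one_lt_of_neg one_lt_two (by linarith)
  obtain ⟨T, hT⟩ := eventually_atTop.1
    (((hL 2 two_pos).eventually (lt_mem_nhds hρ)).and hL.eventually_ne_zero)
  obtain ⟨S, hST, hS1⟩ : ∃ S, T ≤ S ∧ 1 ≤ S := ⟨max T 1, le_max_left _ _, le_max_right _ _⟩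
  have hS0 : 0 < S := one_pos.trans_le hS1
  have hpos : ∀ t, S ≤ t → 0 < G t ∧ 0 < L t := by
    intro t ht
    have ht0 : 0 < t := hS0.trans_le ht
    have h1 := hGL t (hS1.trans ht)
    have h2 : 0 < t ^ (-α) := Real.rpow_pos_of_pos ht0 _
    have h3 : G t ≠ 0 := by
      rw [h1]; exact mul_ne_zero (hT t (hST.trans ht)).2 h2.ne'
    have h4 := (hG0 t).lt_of_ne h3.symm
    refine ⟨h4, ?_⟩
    rw [h1] at h4
    exact pos_of_mul_pos_left h4 h2.le
  -- Doubling `t` multiplies the tail by at least `2^(-(α+ε))`; monotonicity then fills in between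
  -- dyadic points.
  have hdouble : ∀ t, S ≤ t → (2 : ℝ) ^ (-(α + ε)) * G t ≤ G (2 * t) := by
    intro t ht
    have ht0 : 0 < t := hS0.trans_le ht
    have h1 := (hT t (hST.trans ht)).1
    rw [lt_div_iff₀ (hpos t ht).2] at h1
    rw [hGL t (hS1.trans ht), hGL (2 * t) (by linarith), Real.mul_rpow two_pos.le ht0.le,
      neg_add, Real.rpow_add two_pos]
    have h2 : 0 < t ^ (-α) := Real.rpow_pos_of_pos ht0 _
    have h3 : (0 : ℝ) < 2 ^ (-α) := Real.rpow_pos_of_pos two_pos _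
    calc _ = (2 ^ (-ε) * L t) * (2 ^ (-α) * t ^ (-α)) := by ring
      _ ≤ _ := by gcongr
  have hiter : ∀ k : ℕ, ((2 : ℝ) ^ k) ^ (-(α + ε)) * G S ≤ G (2 ^ k * S) := by
    intro k
    induction k with
    | zero => simp
    | succ k ih =>
      have h1 := hdouble (2 ^ k * S) (le_mul_of_one_le_left hS0.le (one_le_pow₀ one_le_two))
      have h2 : (0 : ℝ) < 2 ^ (-(α + ε)) := Real.rpow_pos_of_pos two_pos _
      rw [pow_succ', Real.mul_rpow two_pos.le (by positivity), mul_assoc, mul_assoc]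
      exact (mul_le_mul_of_nonneg_left ih h2.le).trans h1
  refine ⟨(2 / S) ^ (-(α + ε)) * G S, S, mul_pos (Real.rpow_pos_of_pos (by positivity) _)
    (hpos S le_rfl).1, hS0, fun t ht => ?_⟩
  have ht0 : 0 < t := hS0.trans_le ht
  obtain ⟨k, hk1, hk2⟩ := exists_nat_pow_near ((one_le_div hS0).2 ht) one_lt_two
  rw [le_div_iff₀ hS0] at hk1
  rw [div_lt_iff₀ hS0] at hk2
  calc (2 / S) ^ (-(α + ε)) * G S * t ^ (-(α + ε))
      = (2 / S * t) ^ (-(α + ε)) * G S := by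
        rw [Real.mul_rpow (by positivity) ht0.le]; ring
    _ ≤ ((2 : ℝ) ^ (k + 1)) ^ (-(α + ε)) * G S := by
        refine mul_le_mul_of_nonneg_right ?_ (hG0 S)
        refine Real.rpow_le_rpow_of_nonpos (by positivity) ?_ (by linarith)
        rw [pow_succ', div_mul_eq_mul_div, le_div_iff₀ hS0, mul_assoc]
        gcongr
    _ ≤ G (2 ^ (k + 1) * S) := hiter _
    _ ≤ G t := hG hk2.le

/-! ### Normalization and law of the rows. -/

theorem eventually_normSeq_pos (F : Measure ℂ) [IsProbabilityMeasure F] {t : ℝ} (ht : 0 < t)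
    (hF : 0 < F.real {x : ℂ | t ≤ ‖x‖}) : ∀ᶠ n : ℕ in atTop, 0 < normSeq F n := by
  have h1 := (tendsto_natCast_atTop_atTop (R := ℝ)).eventually_gt_atTop
    (F.real {x : ℂ | t ≤ ‖x‖})⁻¹
  filter_upwards [h1, eventually_gt_atTop 0] with n hn hn0
  refine ht.trans_le (le_csInf ?_ ?_)
  · have hn' : (0 : ℝ) < (n : ℝ)⁻¹ := by positivity
    obtain ⟨a, ha, ha0⟩ := (((tendsto_real_setOf_le_norm F).eventually (gt_mem_nhds hn')).and
      (eventually_gt_atTop 0)).exists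
    refine ⟨a, ha0, ?_⟩
    rw [← le_inv_mul_iff₀ (by positivity), mul_one]
    exact ha.le
  · rintro a ⟨-, ha⟩
    by_contra! hat
    have h2 := antitone_real_setOf_le_norm F hat.le
    simp only at h2
    rw [inv_lt_iff_one_lt_mul₀ hF] at hn
    nlinarith [mul_le_mul_of_nonneg_left h2 n.cast_nonneg (α := ℝ)]

theorem IsIIDArray.map_row {Ω : Type*} [MeasurableSpace Ω] {P : Measure Ω}
    [IsProbabilityMeasure P] {F : Measure ℂ} {X : ℕ → ℕ → Ω → ℂ} (hX : IsIIDArray P F X)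
    (n i : ℕ) : P.map (fun ω (j : Fin n) => X i j ω) = Measure.pi fun _ => F := by
  have hinj : Function.Injective fun j : Fin n => (i, (j : ℕ)) := fun a b h => by
    simpa [Fin.ext_iff] using h
  have h := iIndepFun.map_fun_eq_pi_map (f := fun j : Fin n => X i j)
    (fun j => (hX.measurable i j).aemeasurable) (hX.indep.precomp hinj)
  simpa [hX.law] using h

/-- The shift is deterministic and the small ball bound is uniform in it, hence the uniformity in
`z`. -/
theorem scaledRow_eq {Ω : Type*} {F : Measure ℂ} {n : ℕ} (hn : normSeq F n ≠ 0)
    (X : ℕ → ℕ → Ω → ℂ) (z : ℂ) (i : Fin n) (ω : Ω) :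
    scaledRow F X n z i ω = WithLp.toLp 2 (fun j : Fin n => X i j ω)
      + WithLp.toLp 2 (fun j => -(normSeq F n : ℂ) * (z * (1 : Matrix _ _ ℂ) i j)) := by
  have : (normSeq F n : ℂ) ≠ 0 := by exact_mod_cast hn
  ext j
  simp [scaledRow, matA, Matrix.row]
  field_simp
  ring

theorem norm_starProjection_orthogonal_le_infDist {E : Type*} [NormedAddCommGroup E]
    [InnerProductSpace ℂ E] (W : Submodule ℂ E) [W.HasOrthogonalProjection] (x : E) :
    ‖Wᗮ.starProjection x‖ ≤ Metric.infDist x W := by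
  rw [Metric.le_infDist ⟨0, W.zero_mem⟩]
  intro w hw
  have h : Wᗮ.starProjection w = 0 := Submodule.starProjection_orthogonal_apply_eq_zero hw
  rw [dist_eq_norm, ← sub_zero (Wᗮ.starProjection x), ← h, ← map_sub]
  exact Wᗮ.norm_starProjection_apply_le _

theorem IsIIDArray.real_infDist_scaledRow_le {Ω : Type*} [MeasurableSpace Ω] {P : Measure Ω}
    [IsProbabilityMeasure P] {F : Measure ℂ} [IsProbabilityMeasure F] {X : ℕ → ℕ → Ω → ℂ}
    (hX : IsIIDArray P F X) {n : ℕ} (hn : normSeq F n ≠ 0) (z : ℂ) (i : Fin n)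
    (W : Submodule ℂ (EuclideanSpace ℂ (Fin n))) {q s κ : ℝ} (hκ : 0 < κ)
    (hq : ∀ c : ℂ, F.real (Metric.closedBall c (s * √(n / κ))) ≤ q) (m : ℕ)
    (hW : κ + m ≤ n - Module.finrank ℂ W) :
    P.real {ω | Metric.infDist (scaledRow F X n z i ω) W ≤ s} ≤ q ^ m := by
  have hq0 : 0 ≤ q := measureReal_nonneg.trans (hq 0)
  set v : EuclideanSpace ℂ (Fin n) :=
    WithLp.toLp 2 (fun j => -(normSeq F n : ℂ) * (z * (1 : Matrix _ _ ℂ) i j)) with hv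
  have hW' : κ + m ≤ Module.finrank ℂ Wᗮ := by
    have h := W.finrank_add_finrank_orthogonal
    rw [finrank_euclideanSpace_fin] at h
    have h' : (Module.finrank ℂ W : ℝ) + Module.finrank ℂ Wᗮ = n := by exact_mod_cast h
    linarith
  have h := pi_norm_starProjection_le F (ENNReal.ofReal q) hκ
    (fun c => (ENNReal.le_ofReal_iff_toReal_le (measure_ne_top _ _) hq0).2 (hq c)) v m Wᗮ hW'
  rw [← hX.map_row n i] at h
  refine ENNReal.toReal_le_of_le_ofReal (pow_nonneg hq0 m) ?_
  rw [ENNReal.ofReal_pow hq0]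
  refine le_trans ?_ h
  -- This inequality for the image measure needs no measurability of the event.
  refine le_trans (measure_mono ?_) (Measure.le_map_apply ?_ _)
  · intro ω hω
    simp only [Set.mem_ofPred_eq, Set.mem_preimage] at hω ⊢
    rw [scaledRow_eq hn] at hω
    exact (norm_starProjection_orthogonal_le_infDist W _).trans hω
  · exact (measurable_pi_lambda _ fun j : Fin n => hX.measurable i j).aemeasurable

/-! ### Choice of exponents and conclusion. -/

theorem proposition3p3 (α γ : ℝ) (hα0 : 0 < α) (hα2 : α < 2) (hγ0 : 0 < γ) (hγ : γ < 1 / 2) :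
    ∃ δ : ℝ, 0 < δ ∧
      ∀ F : Measure ℂ, IsProbabilityMeasure F → HypH1 α F →
        ∃ N : ℕ, ∀ (Ω : Type*) [MeasurableSpace Ω] (P : Measure Ω) [IsProbabilityMeasure P]
          (X : ℕ → ℕ → Ω → ℂ), IsIIDArray P F X →
          ∀ n : ℕ, N ≤ n → ∀ (z : ℂ) (i : Fin n) (W : Submodule ℂ (EuclideanSpace ℂ (Fin n))),
            (n : ℝ) ^ (1 - γ) ≤ (n : ℝ) - (Module.finrank ℂ W : ℝ) →
            P.real {ω | Metric.infDist (scaledRow F X n z i ω)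
                (W : Set (EuclideanSpace ℂ (Fin n))) ≤ (n : ℝ) ^ ((1 - 2 * γ) / α)}
              ≤ Real.exp (-(n : ℝ) ^ δ) := by
  -- `η = 1 - γ - αβ`, and `βε = η/4`. Of the remaining `3η/4`, `η/2` becomes `δ` and `η/4` absorbs
  -- the constants.
  obtain ⟨η, hη⟩ : ∃ η, η = γ * (1 - α / 2) := ⟨_, rfl⟩
  obtain ⟨β, hβ⟩ : ∃ β, β = (1 - 2 * γ) / α + γ / 2 := ⟨_, rfl⟩
  obtain ⟨ε, hε⟩ : ∃ ε, ε = η / (4 * β) := ⟨_, rfl⟩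
  have hη0 : 0 < η := hη ▸ mul_pos hγ0 (by linarith)
  have hβ0 : 0 < β := hβ ▸ add_pos (div_pos (by linarith) hα0) (by linarith)
  have hε0 : 0 < ε := hε ▸ by positivity
  have hexp : 1 - γ - β * (α + ε) = η / 2 + η / 4 := by
    have h1 : β * ε = η / 4 := by rw [hε]; field_simp
    have h2 : β * α = 1 - 2 * γ + γ * α / 2 := by rw [hβ]; field_simp
    rw [mul_add, h1, h2, hη]; ring
  refine ⟨η / 2, by positivity, fun F hF hH => ?_⟩
  obtain ⟨⟨L, hL, hFL⟩, -⟩ := hH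
  obtain ⟨C, T, hC, hT, hlow⟩ := hL.exists_rpow_le hα0 hε0 (antitone_real_setOf_le_norm F)
    (fun _ => measureReal_nonneg) hFL
  have htop : ∀ a : ℝ, 0 < a → Tendsto (fun n : ℕ => (n : ℝ) ^ a) atTop atTop :=
    fun a ha => (tendsto_rpow_atTop ha).comp tendsto_natCast_atTop_atTop
  -- The `8` comes from the threshold `4 * (2 * n^β)`, the `1/4` from `⌊D/2⌋₊ ≥ D/4`, valid once `D
  -- ≥ 4`.
  obtain ⟨C', hC'⟩ : ∃ C', C' = 8 ^ (-(α + ε)) * C / 4 := ⟨_, rfl⟩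
  have hC'0 : 0 < C' := hC' ▸ by positivity
  have hT0 : 0 < F.real {x : ℂ | T ≤ ‖x‖} :=
    (mul_pos hC (Real.rpow_pos_of_pos hT _)).trans_le (hlow T le_rfl)
  have htail : ∀ᶠ n : ℕ in atTop, F.real {x : ℂ | 2 * (n : ℝ) ^ β ≤ ‖x‖} < 1 / 2 :=
    ((tendsto_real_setOf_le_norm F).comp ((htop β hβ0).const_mul_atTop two_pos)).eventually
      (gt_mem_nhds one_half_pos)
  obtain ⟨N, hN⟩ := eventually_atTop.1 ((((((eventually_normSeq_pos F hT hT0).and htail).and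
    ((htop (1 - γ) (by linarith)).eventually_ge_atTop 4)).and
    ((htop β hβ0).eventually_ge_atTop T)).and
    ((htop (η / 4) (by positivity)).eventually_ge_atTop C'⁻¹)).and (eventually_gt_atTop 0))
  refine ⟨N, fun Ω _ P _ X hX n hn z i W hW => ?_⟩
  obtain ⟨⟨⟨⟨⟨hpos, hhalf⟩, h4⟩, hTn⟩, hCn⟩, hn0⟩ := hN n hn
  have hn0' : (0 : ℝ) < n := Nat.cast_pos.2 hn0
  set D := (n : ℝ) ^ (1 - γ) with hD
  have hnβ : 0 < (n : ℝ) ^ β := Real.rpow_pos_of_pos hn0' _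
  have hm : D / 4 ≤ ⌊D / 2⌋₊ := by
    have := Nat.lt_floor_add_one (D / 2)
    linarith
  have hm' : (⌊D / 2⌋₊ : ℝ) ≤ D / 2 := Nat.floor_le (by linarith)
  have hradius : (n : ℝ) ^ ((1 - 2 * γ) / α) * √(n / (D / 2)) ≤ 2 * (n : ℝ) ^ β := by
    have h1 : (n : ℝ) / (D / 2) = 2 * (n : ℝ) ^ γ := by
      rw [hD, Real.rpow_sub hn0', Real.rpow_one]
      field_simp
    have h2 : √((n : ℝ) ^ γ) = (n : ℝ) ^ (γ / 2) := by
      rw [Real.sqrt_eq_rpow, ← Real.rpow_mul hn0'.le]; congr 1; ring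
    rw [h1, Real.sqrt_mul two_pos.le, h2, hβ, Real.rpow_add hn0']
    have h3 : √2 ≤ 2 := by rw [Real.sqrt_le_left two_pos.le]; norm_num
    calc _ = √2 * ((n : ℝ) ^ ((1 - 2 * γ) / α) * (n : ℝ) ^ (γ / 2)) := by ring
      _ ≤ _ := by gcongr
  set p := F.real {x : ℂ | 4 * (2 * (n : ℝ) ^ β) ≤ ‖x‖} with hp
  have hball : ∀ c : ℂ, F.real (Metric.closedBall c
      ((n : ℝ) ^ ((1 - 2 * γ) / α) * √(n / (D / 2)))) ≤ 1 - p := fun c =>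
    (measureReal_mono (Metric.closedBall_subset_closedBall hradius)).trans
      (real_closedBall_le_one_sub F (by positivity) hhalf.le c)
  have hplow : 4 * C' * (n : ℝ) ^ (-(β * (α + ε))) ≤ p := by
    have h1 := hlow (4 * (2 * (n : ℝ) ^ β)) (by linarith)
    rw [← mul_assoc 4, Real.mul_rpow (by norm_num) hnβ.le, ← Real.rpow_mul hn0'.le] at h1
    norm_num only at h1
    rw [hp, hC']
    refine le_trans (le_of_eq ?_) (h1.trans (le_of_eq ?_))
    · rw [mul_neg]; ring
    · rw [← mul_assoc]; norm_num
  have hmp : (n : ℝ) ^ (η / 2) ≤ ⌊D / 2⌋₊ * p := by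
    have h1 : D * (n : ℝ) ^ (-(β * (α + ε))) = (n : ℝ) ^ (η / 2) * (n : ℝ) ^ (η / 4) := by
      rw [hD, ← Real.rpow_add hn0', ← Real.rpow_add hn0', ← hexp, sub_eq_add_neg (1 - γ)]
    rw [inv_le_iff_one_le_mul₀ hC'0] at hCn
    calc (n : ℝ) ^ (η / 2) ≤ (n : ℝ) ^ (η / 2) * ((n : ℝ) ^ (η / 4) * C') :=
          le_mul_of_one_le_right (by positivity) hCn
      _ = D / 4 * (4 * C' * (n : ℝ) ^ (-(β * (α + ε)))) := by
          rw [← mul_assoc, ← h1]; ring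
      _ ≤ ⌊D / 2⌋₊ * p := by gcongr
  have hp1 : p ≤ 1 := measureReal_le_one
  -- Half of the codimension serves as `κ`, the other half as the number of peeled directions.
  calc _ ≤ (1 - p) ^ ⌊D / 2⌋₊ := hX.real_infDist_scaledRow_le hpos.ne' z i W
        (by linarith) hball _ (by linarith)
    _ ≤ Real.exp (-p) ^ ⌊D / 2⌋₊ := by
        exact pow_le_pow_left₀ (by linarith) (Real.one_sub_le_exp_neg p) _
    _ = Real.exp (-(⌊D / 2⌋₊ * p)) := by rw [← Real.exp_nat_mul, mul_neg]
    _ ≤ _ := by gcongr
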